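/- Let $X$ be a real reflexive Banach space and $Z$ a real Hausdorff locally convex topological vector space. Let $C\subseteq Z$ be a convex pointed cone (i.e. $tC\subseteq C$ for all $t\ge 0$, $C+C=C$, $C\cap(-C)=\{0\}$) with nonempty interior $\operatorname{int}C$, and let $K\subseteq X$ be nonempty, convex and closed. Let $D\subseteq K$ be self-segment-dense in $K$ in the weak topology of $X$; that is, $D$ is weakly dense in $K$, and for all $x,y\in D$ the set $[x,y]\cap D$ is weakly dense in the segment $[x,y]$. Let $f:K\times K\to Z$ satisfy: (i) for every $y\in D$, the map $x\mapsto f(x,y)$ is $C$-upper semicontinuous at every point of $K$, in the weak topology of $X$; (ii) for every $x\in K$, the map $y\mapsto f(x,y)$ is $C$-upper semicontinuous at every point of $K\setminus D$, in the weak topology of $X$; (iii) for every $x\in K$, the map $y\mapsto f(x,y)$ is $C$-convex on $D$; (iv) for every $x\in D$, $f(x,x)\notin-\operatorname{int}C$; (v) there is $r>0$ such that $K\cap\{x\in X:\|x\|\le r\}\neq\emptyset$ and, for every $x\in K$ with $\|x\|\le r$, there exists $y_0\in D$ with $\|y_0\|<r$ and $f(x,y_0)\in-\operatorname{int}C\cup\{0\}$.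 Then there exists $x_0\in K$ such that $f(x_0,y)\notin-\operatorname{int}C$ for all $y\in K$. Here a map $g:K\to Z$ is $C$-upper semicontinuous at $x\in K$ if for every neighbourhood $V$ of $g(x)$ there is a (weak) neighbourhood $U$ of $x$ such that $g(u)\in V-C$ for all $u\in U\cap K$; and $g$ is $C$-convex on $D$ if $\sum_{i=1}^n\lambda_i g(x_i)-g\bigl(\sum_{i=1}^n\lambda_i x_i\bigr)\in C$ whenever $n\in\mathbb N$, $x_1,\dots,x_n\in D$, $\lambda_i\ge0$, $\sum_{i=1}^n\lambda_i=1$ and $\sum_{i=1}^n\lambda_i x_i\in D$. -/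

import Mathlib

open scoped Pointwise Topology

/-- A real normed space is reflexive if the canonical isometric embedding into its bidual is
onto. -/
def IsReflexiveSpace (X : Type*) [NormedAddCommGroup X] [NormedSpace ℝ X] : Prop :=
  Function.Surjective (NormedSpace.inclusionInDoubleDual ℝ X)

/-- `U` is self-segment-dense in the convex set `V`: `U ⊆ V`, `U` is dense in `V`, and for all
`x, y ∈ U` the set `[x, y] ∩ U` is dense in the closed segment `[x, y]`. -/
structure SelfSegmentDense {E : Type*} [AddCommGroup E] [Module ℝ E] [TopologicalSpace E]
    (U V : Set E) : Prop where
  convex : Convex ℝ V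
  subset : U ⊆ V
  dense : V ⊆ closure U
  segment_dense : ∀ x ∈ U, ∀ y ∈ U, segment ℝ x y ⊆ closure (segment ℝ x y ∩ U)

/-- The map `g : K → Z` is `C`-upper semicontinuous at `x`: for every neighbourhood `V` of `g x`
there is a neighbourhood `U` of `x` such that `g u ∈ V - C` for all `u ∈ U ∩ K`. Only the
restriction of `g` to `K` matters when `x ∈ K`. -/
def CUpperSemicontinuousWithinAt {E Z : Type*} [TopologicalSpace E]
    [AddCommGroup Z] [Module ℝ Z] [TopologicalSpace Z]
    (C : PointedCone ℝ Z) (g : E → Z) (K : Set E) (x : E) : Prop :=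
  ∀ V ∈ 𝓝 (g x), ∃ U ∈ 𝓝 x, ∀ u ∈ U ∩ K, g u ∈ V - (C : Set Z)

/-- `g` is `C`-convex on the (not necessarily convex) set `S`: for all convex combinations of
points of `S` that again lie in `S`, `g (∑ wᵢ xᵢ) ≤ ∑ wᵢ g (xᵢ)` in the order
`a ≤ b ↔ b - a ∈ C`. -/
def CConvexOn {E Z : Type*} [AddCommGroup E] [Module ℝ E] [AddCommGroup Z] [Module ℝ Z]
    (C : PointedCone ℝ Z) (g : E → Z) (S : Set E) : Prop :=
  ∀ (n : ℕ) (x : Fin n → E) (w : Fin n → ℝ), (∀ i, x i ∈ S) → (∀ i, 0 ≤ w i) →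
    ∑ i, w i = 1 → ∑ i, w i • x i ∈ S →
      (∑ i, w i • g (x i)) - g (∑ i, w i • x i) ∈ C

/-! The problem is first solved on the weakly compact convex set `M = K ∩ closedBall 0 r`. For `y ∈
D ∩ M` the set of `x ∈ M` with `f x y ∉ -int C` is weakly closed by (i). These sets satisfy the KKM
covering condition: at points of `D` in the hull of finitely many `y`'s it follows from
`C`-convexity and (iv). Since a self-segment-dense set is dense in such hulls and a finite union of
closed sets is closed, it extends to the whole hull. KKM and compactness then give `x₀`, a solution
against all `y ∈ D ∩ M`.

The bound on the norm of `y` is removed by (v): it provides `y₀ ∈ D` with `‖y₀‖ < r` and `f x₀ y₀ =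
0`. If `f x₀ y ∈ -int C` for a far `y ∈ D`, convexity makes `f x₀` strictly negative at points of
`D` on `[y₀, y]` close to `y₀`, a contradiction. Finally (ii) and the density of `D` handle `y ∈ K \
D`.

The KKM lemma is derived from Scarf's lemma, a parity argument on finite sets with linear rankings,
applied to finer and finer grids in the simplex. -/

/-! ### Dominant sets and Scarf's lemma. -/

/-- A finite set `S` is dominant for the family of rankings `p` if no point is ranked strictly
above the minimum of `S` by every ranking. -/
def IsDominant {I V α : Type*} [LinearOrder α] (p : I → V → α) (S : Finset V) : Prop :=
  ∀ y, ∃ i, ∀ x ∈ S, p i y ≤ p i x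

theorem IsDominant.mono {I V α : Type*} [LinearOrder α] {p : I → V → α} {S T : Finset V}
    (hS : IsDominant p S) (h : T ⊆ S) : IsDominant p T := fun y => by
  obtain ⟨i, hi⟩ := hS y
  exact ⟨i, fun x hx => hi x (h hx)⟩

section Door

variable {I V α : Type*} [DecidableEq V] [LinearOrder α] {p : I → V → α}
  {τ : Finset V} {m : I → V}

/-- Adding to a dominant set the `k`-best of the points that beat all other minima keeps it
dominant. -/
theorem IsDominant.insert_of_isMax (hp : ∀ i, Function.Injective (p i))
    (hτ : IsDominant p τ) (hm : ∀ i, m i ∈ τ) (hmin : ∀ i, ∀ x ∈ τ, p i (m i) ≤ p i x) {k : I}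
    (hsurj : ∀ t ∈ τ, ∃ l, l ≠ k ∧ m l = t) {x : V}
    (hx : ∀ l, l ≠ k → p l (m l) < p l x)
    (hmax : ∀ y, (∀ l, l ≠ k → p l (m l) < p l y) → p k y ≤ p k x) :
    x ∉ τ ∧ p k x < p k (m k) ∧ IsDominant p (insert x τ) := by
  have hxτ : x ∉ τ := fun h => by
    obtain ⟨l, hl, rfl⟩ := hsurj x h
    exact lt_irrefl _ (hx l hl)
  -- Some ranking places `x` below all of `τ`; it can only be `k`, as `x` beats every other minimum.
  have hlt : p k x < p k (m k) := by
    obtain ⟨l, hl⟩ := hτ x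
    have hlk : l = k := by
      by_contra h
      exact absurd (hl _ (hm l)) (not_le.2 (hx l h))
    subst hlk
    refine lt_of_le_of_ne (hl _ (hm l)) fun h => hxτ ?_
    rw [hp l h]
    exact hm l
  refine ⟨hxτ, hlt, fun y => ?_⟩
  by_cases hy : ∀ l, l ≠ k → p l (m l) < p l y
  · refine ⟨k, fun z hz => ?_⟩
    rcases Finset.mem_insert.1 hz with rfl | hz
    · exact hmax y hy
    · exact (hmax y hy).trans (hlt.le.trans (hmin k z hz))
  · push Not at hy
    obtain ⟨l, hl, hly⟩ := hy
    refine ⟨l, fun z hz => ?_⟩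
    rcases Finset.mem_insert.1 hz with rfl | hz
    · exact hly.trans (hx l hl).le
    · exact hly.trans (hmin l z hz)

/-- If adding `x` to a dominant set keeps it dominant, then `x` becomes the minimum of one of the
two rankings which share their minimum. -/
theorem IsDominant.exists_of_insert (hp : ∀ i, Function.Injective (p i))
    (hm : ∀ i, m i ∈ τ) (hmin : ∀ i, ∀ x ∈ τ, p i (m i) ≤ p i x) {x : V} (hxτ : x ∉ τ)
    (hx : IsDominant p (insert x τ)) :
    ∃ k l, k ≠ l ∧ m k = m l ∧ ((∀ a b, a ≠ k → b ≠ k → m a = m b → a = b) →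
      (∀ l, l ≠ k → p l (m l) < p l x) ∧
      ∀ y, (∀ l, l ≠ k → p l (m l) < p l y) → p k y ≤ p k x) := by
  -- In ranking `k` the new point is the minimum. By `key`, every `t ∈ τ` is the minimum of `τ` in
  -- some ranking other than `k`; for `t = m k` this gives the coincidence.
  obtain ⟨k, hk⟩ := hx x
  have key : ∀ t ∈ τ, ∃ l, l ≠ k ∧ m l = t ∧ p l t ≤ p l x := fun t ht => by
    obtain ⟨l, hl⟩ := hx t
    refine ⟨l, ?_, ?_, hl x (Finset.mem_insert_self _ _)⟩
    · rintro rfl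
      have := le_antisymm (hk t (Finset.mem_insert_of_mem ht)) (hl x (Finset.mem_insert_self _ _))
      exact hxτ (hp l this ▸ ht)
    · exact hp l (le_antisymm (hmin l t ht) (hl _ (Finset.mem_insert_of_mem (hm l))))
  obtain ⟨l, hlk, hl, -⟩ := key (m k) (hm k)
  refine ⟨k, l, hlk.symm, hl.symm, fun hinj => ?_⟩
  have h1 : ∀ l, l ≠ k → p l (m l) < p l x := fun l hl => by
    obtain ⟨a, hak, ha, hle⟩ := key (m l) (hm l)
    obtain rfl := hinj a l hak hl ha
    exact lt_of_le_of_ne hle fun h => hxτ (hp a h ▸ hm a)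
  refine ⟨h1, fun y hy => ?_⟩
  obtain ⟨a, ha⟩ := hx y
  have hak : a = k := by
    by_contra h
    exact absurd (ha _ (Finset.mem_insert_of_mem (hm a))) (not_le.2 (hy a h))
  exact hak ▸ ha x (Finset.mem_insert_self _ _)

/-- A nonempty dominant set with one element less than the number of rankings lies in exactly two
dominant sets with one more element, provided it has candidates for both extensions. -/
theorem IsDominant.card_insert_eq_two [Fintype V] [Fintype I] [DecidableEq I]
    (hp : ∀ i, Function.Injective (p i)) (hτ : IsDominant p τ)
    (hcard : τ.card + 1 = Fintype.card I) (hm : ∀ i, m i ∈ τ)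
    (hmin : ∀ i, ∀ x ∈ τ, p i (m i) ≤ p i x)
    (hcand : ∀ k, ∃ y, ∀ l, l ≠ k → p l (m l) < p l y) (R : Finset (Finset V))
    (hR : ∀ S, S ∈ R ↔ IsDominant p S ∧ S.card = Fintype.card I ∧ τ ⊆ S) : R.card = 2 := by
  have hsurj : ∀ t ∈ τ, ∃ l, m l = t := fun t ht => by
    obtain ⟨l, hl⟩ := hτ t
    exact ⟨l, hp l (le_antisymm (hmin l t ht) (hl _ (hm l)))⟩
  -- The minima exhaust `τ`, which has one element fewer than there are rankings, so exactly one
  -- pair `i`, `j` shares its minimum. The two extensions replace the minimum of ranking `i` or of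
  -- ranking `j`.
  obtain ⟨i, -, j, -, hij, hmij⟩ :=
    Finset.exists_ne_map_eq_of_card_lt_of_maps_to (s := Finset.univ) (t := τ) (f := m)
      (by rw [Finset.card_univ]; omega) (fun a _ => hm a)
  have hsurj' : ∀ k k', k ≠ k' → m k = m k' → ∀ t ∈ τ, ∃ l, l ≠ k ∧ m l = t := by
    intro k k' hkk hmk t ht
    obtain ⟨l, hl⟩ := hsurj t ht
    by_cases h : l = k
    · exact ⟨k', hkk.symm, by rw [← hmk, ← h, hl]⟩
    · exact ⟨l, h, hl⟩
  have hinj : ∀ k k', k ≠ k' → m k = m k' → ∀ a b, a ≠ k → b ≠ k → m a = m b → a = b := by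
    intro k k' hkk hmk a b ha hb hab
    have him : (Finset.univ.erase k).image m = τ := by
      ext t
      simp only [Finset.mem_image, Finset.mem_erase, Finset.mem_univ, and_true]
      exact ⟨fun ⟨l, _, hl⟩ => hl ▸ hm l, hsurj' k k' hkk hmk t⟩
    have hc : ((Finset.univ.erase k).image m).card = (Finset.univ.erase k).card := by
      rw [him, Finset.card_erase_of_mem (Finset.mem_univ _), Finset.card_univ]; omega
    exact Finset.injOn_of_card_image_eq hc (by simpa using ha) (by simpa using hb) hab
  have hmaxex : ∀ k, ∃ x, (∀ l, l ≠ k → p l (m l) < p l x) ∧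
      ∀ y, (∀ l, l ≠ k → p l (m l) < p l y) → p k y ≤ p k x := fun k => by
    obtain ⟨x, hx, hxm⟩ := Finset.exists_max_image
      (Finset.univ.filter fun y => ∀ l, l ≠ k → p l (m l) < p l y) (p k)
      (by obtain ⟨y, hy⟩ := hcand k; exact ⟨y, by simpa using hy⟩)
    exact ⟨x, by simpa using hx, fun y hy => hxm y (by simpa using hy)⟩
  choose X hX hXmax using hmaxex
  have hpair : ∀ k k', k ≠ k' → m k = m k' → k = i ∨ k = j := by
    intro k k' hkk hmk
    by_contra! h
    have h1 := hinj i j hij hmij k k'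
    have h2 := hinj j i hij.symm hmij.symm k k'
    by_cases hk : k' = i
    · exact hkk (h2 h.2 (hk ▸ hij) hmk)
    · exact hkk (h1 h.1 hk hmk)
  have hi := hτ.insert_of_isMax hp hm hmin (hsurj' i j hij hmij) (hX i) (hXmax i)
  have hj := hτ.insert_of_isMax hp hm hmin (hsurj' j i hij.symm hmij.symm) (hX j) (hXmax j)
  have hne : X i ≠ X j := fun h => by
    have := hX j i hij
    rw [← h] at this
    exact lt_asymm this hi.2.1
  have hReq : R = {insert (X i) τ, insert (X j) τ} := by
    ext S
    rw [hR, Finset.mem_insert, Finset.mem_singleton]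
    constructor
    · rintro ⟨hS, hSc, hτS⟩
      obtain ⟨x, hx⟩ : ∃ x, S \ τ = {x} := by
        rw [← Finset.card_eq_one, Finset.card_sdiff_of_subset hτS]; omega
      have hxS : S = insert x τ := by
        rw [← Finset.sdiff_union_of_subset hτS, hx, Finset.insert_eq]
      have hxτ : x ∉ τ := (Finset.mem_sdiff.1 (hx ▸ Finset.mem_singleton_self x)).2
      subst hxS
      obtain ⟨k, k', hkk, hmk, hk⟩ := IsDominant.exists_of_insert hp hm hmin hxτ hS
      obtain ⟨h1, h2⟩ := hk (hinj k k' hkk hmk)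
      have hxX : x = X k := hp k (le_antisymm (hXmax k x h1) (h2 _ (hX k)))
      rcases hpair k k' hkk hmk with rfl | rfl
      · exact Or.inl (by rw [hxX])
      · exact Or.inr (by rw [hxX])
    · rintro (rfl | rfl)
      · exact ⟨hi.2.2, by rw [Finset.card_insert_of_notMem hi.1, hcard], Finset.subset_insert _ _⟩
      · exact ⟨hj.2.2, by rw [Finset.card_insert_of_notMem hj.1, hcard], Finset.subset_insert _ _⟩
  rw [hReq, Finset.card_pair]
  intro h
  have : X i ∈ insert (X j) τ := h ▸ Finset.mem_insert_self _ _
  rcases Finset.mem_insert.1 this with h | h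
  · exact hne h
  · exact hi.1 h

end Door

/-- A set that misses at most one colour but is not fully coloured has exactly zero or two
subsets carrying all colours other than `i₀` exactly once. -/
theorem even_card_facets {I V : Type*} [Fintype I] [DecidableEq I] [DecidableEq V] (c : V → I)
    (i₀ : I) {S : Finset V} (hS : S.card = Fintype.card I) (hnot : S.image c ≠ Finset.univ)
    (A : Finset (Finset V))
    (hA : ∀ τ, τ ∈ A ↔ τ ⊆ S ∧ τ.card + 1 = Fintype.card I ∧ τ.image c = Finset.univ.erase i₀) :
    Even A.card := by
  rcases A.eq_empty_or_nonempty with rfl | ⟨τ, hτ⟩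
  · simp
  obtain ⟨hτS, hτc, hτi⟩ := (hA τ).1 hτ
  obtain ⟨x, hx⟩ : ∃ x, S \ τ = {x} := by
    rw [← Finset.card_eq_one, Finset.card_sdiff_of_subset hτS]; omega
  have hxS : S = insert x τ := by
    rw [← Finset.sdiff_union_of_subset hτS, hx, Finset.insert_eq]
  have hxτ : x ∉ τ := (Finset.mem_sdiff.1 (hx ▸ Finset.mem_singleton_self x)).2
  have hinj : Set.InjOn c (τ : Set V) := by
    apply Finset.injOn_of_card_image_eq
    rw [hτi, Finset.card_erase_of_mem (Finset.mem_univ _), Finset.card_univ]; omega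
  -- The colour of `x` is thus repeated by a unique `y ∈ τ`, and only deleting `x` or `y` removes
  -- the repetition.
  have hcx : c x ≠ i₀ := fun h => hnot (by
    rw [hxS, Finset.image_insert, hτi, h, Finset.insert_erase (Finset.mem_univ _)])
  obtain ⟨y, hyτ, hy⟩ : ∃ y ∈ τ, c y = c x := by
    have : c x ∈ τ.image c := by rw [hτi]; simpa using hcx
    simpa using this
  have hyx : y ≠ x := fun h => hxτ (h ▸ hyτ)
  have hyS : y ∈ S := hτS hyτ
  have hyim : (S.erase y).image c = Finset.univ.erase i₀ := by
    rw [← hτi, hxS, Finset.erase_insert_of_ne hyx.symm, Finset.image_insert]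
    ext a
    simp only [Finset.mem_insert, Finset.mem_image, Finset.mem_erase]
    constructor
    · rintro (rfl | ⟨b, hb, rfl⟩)
      · exact ⟨y, hyτ, hy⟩
      · exact ⟨b, hb.2, rfl⟩
    · rintro ⟨b, hb, rfl⟩
      by_cases h : b = y
      · exact Or.inl (by rw [h, hy])
      · exact Or.inr ⟨b, ⟨h, hb⟩, rfl⟩
  have hAeq : A = {τ, S.erase y} := by
    ext ρ
    rw [hA, Finset.mem_insert, Finset.mem_singleton]
    constructor
    · rintro ⟨hρS, hρc, hρi⟩
      obtain ⟨z, hz⟩ : ∃ z, S \ ρ = {z} := by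
        rw [← Finset.card_eq_one, Finset.card_sdiff_of_subset hρS]; omega
      have hρ : ρ = S.erase z := by
        rw [Finset.erase_eq, ← hz, Finset.sdiff_sdiff_eq_self hρS]
      have hzS : z ∈ S := (Finset.mem_sdiff.1 (hz ▸ Finset.mem_singleton_self z)).1
      have hρinj : Set.InjOn c (ρ : Set V) := by
        apply Finset.injOn_of_card_image_eq
        rw [hρi, Finset.card_erase_of_mem (Finset.mem_univ _), Finset.card_univ]; omega
      by_cases hzx : z = x
      · left
        rw [hρ, hzx, hxS, Finset.erase_insert hxτ]
      · by_cases hzy : z = y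
        · right; rw [hρ, hzy]
        · exfalso
          have hxρ : x ∈ ρ := by
            rw [hρ, Finset.mem_erase, hxS]; exact ⟨Ne.symm hzx, Finset.mem_insert_self _ _⟩
          have hyρ : y ∈ ρ := by rw [hρ, Finset.mem_erase]; exact ⟨Ne.symm hzy, hyS⟩
          exact hyx (hρinj hyρ hxρ hy)
    · rintro (rfl | rfl)
      · exact ⟨hτS, hτc, hτi⟩
      · refine ⟨Finset.erase_subset _ _, ?_, hyim⟩
        rw [Finset.card_erase_add_one hyS, hS]
  rw [hAeq, Finset.card_pair]
  · exact even_two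
  · intro h
    rw [h] at hyτ
    simp at hyτ

/-- **Scarf's lemma.** -/
theorem exists_isDominant_image_eq_univ {I V α : Type*} [Fintype I] [DecidableEq I] [Fintype V]
    [DecidableEq V] [LinearOrder α] (p : I → V → α) (hp : ∀ i, Function.Injective (p i))
    (e : I → V) (hlow : ∀ i v, v ≠ e i → p i (e i) < p i v)
    (hhigh : ∀ i j v, i ≠ j → v ∉ Set.range e → p i v < p i (e j))
    (hne : ∃ v, v ∉ Set.range e) (c : V → I) (hc : ∀ i, c (e i) = i) [Nonempty I] :
    ∃ S : Finset V, IsDominant p S ∧ S.image c = Finset.univ := by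
  classical
  obtain ⟨i₀⟩ := ‹Nonempty I›
  by_contra! hno
  have he : Function.Injective e := fun a b h => by rw [← hc a, h, hc b]
  let rooms : Finset (Finset V) :=
    Finset.univ.filter fun S => IsDominant p S ∧ S.card = Fintype.card I
  let doors : Finset (Finset V) := Finset.univ.filter fun τ => IsDominant p τ ∧
    τ.card + 1 = Fintype.card I ∧ τ.image c = Finset.univ.erase i₀
  let τ₀ : Finset V := (Finset.univ.erase i₀).image e
  -- Incidences between doors and rooms are counted twice. Without a fully coloured room each room
  -- has an even number of doors, whereas `τ₀` lies in one room and every other door in two, so the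
  -- total is odd.
  have hcount := Finset.sum_card_bipartiteAbove_eq_sum_card_bipartiteBelow
    (s := doors) (t := rooms) (fun τ S => τ ⊆ S)
  have heven : Even (∑ S ∈ rooms, (doors.bipartiteBelow (fun τ S => τ ⊆ S) S).card) := by
    refine Finset.even_sum _ fun S hS => ?_
    simp only [rooms, Finset.mem_filter, Finset.mem_univ, true_and] at hS
    refine even_card_facets c i₀ hS.2 (hno S hS.1) _ fun τ => ?_
    simp only [Finset.mem_bipartiteBelow, doors, Finset.mem_filter, Finset.mem_univ, true_and]
    exact ⟨fun h => ⟨h.2, h.1.2⟩, fun h => ⟨⟨hS.1.mono h.1, h.2⟩, h.1⟩⟩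
  have hτ₀mem : ∀ v, v ∈ τ₀ ↔ ∃ i, i ≠ i₀ ∧ e i = v := fun v => by simp [τ₀]
  have hτ₀card : τ₀.card + 1 = Fintype.card I := by
    rw [Finset.card_image_of_injective _ he, Finset.card_erase_add_one (Finset.mem_univ _),
      Finset.card_univ]
  have hτ₀door : τ₀ ∈ doors := by
    simp only [doors, Finset.mem_filter, Finset.mem_univ, true_and]
    refine ⟨fun y => ?_, hτ₀card, ?_⟩
    · by_cases hy : y ∈ Set.range e
      · obtain ⟨k, rfl⟩ := hy
        refine ⟨k, fun x _ => ?_⟩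
        by_cases hx : x = e k
        · rw [hx]
        · exact (hlow k x hx).le
      · refine ⟨i₀, fun x hx => ?_⟩
        obtain ⟨j, hj, rfl⟩ := (hτ₀mem x).1 hx
        exact (hhigh i₀ j y hj.symm hy).le
    · simp [τ₀, Finset.image_image, Function.comp_def, hc]
  -- The only possible extra element is the `p i₀`-best point outside the range of `e`: for `k ≠ i₀`
  -- the presence of `e k` prevents ranking `k` from placing a point outside that range below the
  -- whole set.
  have hone : (rooms.bipartiteAbove (fun τ S => τ ⊆ S) τ₀).card = 1 := by
    obtain ⟨x, hx, hxmax⟩ := Finset.exists_max_image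
      (Finset.univ.filter fun v => v ∉ Set.range e) (p i₀)
      (by obtain ⟨v, hv⟩ := hne; exact ⟨v, by simpa using hv⟩)
    replace hx : x ∉ Set.range e := (Finset.mem_filter.1 hx).2
    replace hxmax : ∀ y, y ∉ Set.range e → p i₀ y ≤ p i₀ x := fun y hy =>
      hxmax y (Finset.mem_filter.2 ⟨Finset.mem_univ _, hy⟩)
    have hxτ : x ∉ τ₀ := fun h => by
      obtain ⟨i, -, rfl⟩ := (hτ₀mem x).1 h
      exact hx ⟨i, rfl⟩
    rw [Finset.card_eq_one]
    refine ⟨insert x τ₀, ?_⟩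
    ext S
    simp only [Finset.mem_bipartiteAbove, rooms, Finset.mem_filter, Finset.mem_univ, true_and,
      Finset.mem_singleton]
    constructor
    · rintro ⟨⟨hS, hSc⟩, hτS⟩
      obtain ⟨z, hz⟩ : ∃ z, S \ τ₀ = {z} := by
        rw [← Finset.card_eq_one, Finset.card_sdiff_of_subset hτS]; omega
      have hzS : S = insert z τ₀ := by
        rw [← Finset.sdiff_union_of_subset hτS, hz, Finset.insert_eq]
      have hzτ : z ∉ τ₀ := (Finset.mem_sdiff.1 (hz ▸ Finset.mem_singleton_self z)).2
      obtain ⟨k, hk⟩ := hS x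
      have hk₀ : k = i₀ := by
        by_contra h
        have h1 : e k ∈ S := hτS ((hτ₀mem _).2 ⟨k, h, rfl⟩)
        exact absurd (hk _ h1) (not_le.2 (hlow k x fun h' => hx ⟨k, h'.symm⟩))
      subst hk₀
      have hxz : p k x ≤ p k z := hk z (hzS ▸ Finset.mem_insert_self _ _)
      have hzr : z ∉ Set.range e := by
        rintro ⟨l, rfl⟩
        by_cases hl : l = k
        · subst hl
          exact absurd hxz (not_le.2 (hlow l x fun h' => hx ⟨l, h'.symm⟩))
        · exact hzτ ((hτ₀mem _).2 ⟨l, hl, rfl⟩)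
      rw [hzS, hp k (le_antisymm hxz (hxmax z hzr))]
    · rintro rfl
      refine ⟨⟨fun y => ?_, by rw [Finset.card_insert_of_notMem hxτ, hτ₀card]⟩,
        Finset.subset_insert _ _⟩
      by_cases hy : y ∈ Set.range e
      · obtain ⟨k, rfl⟩ := hy
        refine ⟨k, fun x _ => ?_⟩
        by_cases hx : x = e k
        · rw [hx]
        · exact (hlow k x hx).le
      · refine ⟨i₀, fun z hz => ?_⟩
        rcases Finset.mem_insert.1 hz with rfl | hz
        · exact hxmax y hy
        · obtain ⟨j, hj, rfl⟩ := (hτ₀mem z).1 hz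
          exact (hhigh i₀ j y hj.symm hy).le
  have htwo : ∀ τ ∈ doors.erase τ₀, (rooms.bipartiteAbove (fun τ S => τ ⊆ S) τ).card = 2 := by
    intro τ hτ
    simp only [doors, Finset.mem_erase, Finset.mem_filter, Finset.mem_univ, true_and] at hτ
    obtain ⟨hτne, hτd, hτc, hτi⟩ := hτ
    have hsub : ∀ τ' : Finset V, τ'.card + 1 = Fintype.card I → τ ⊆ τ' → τ = τ' :=
      fun τ' h h' => Finset.eq_of_subset_of_card_le h' (by omega)
    have hτnon : τ.Nonempty := by
      rw [Finset.nonempty_iff_ne_empty]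
      rintro rfl
      exact hτne (hsub τ₀ hτ₀card (Finset.empty_subset _))
    have hmex : ∀ i, ∃ v ∈ τ, ∀ x ∈ τ, p i v ≤ p i x := fun i =>
      Finset.exists_min_image τ (p i) hτnon
    choose m hm hmin using hmex
    refine hτd.card_insert_eq_two hp hτc hm hmin (fun k => ⟨e k, fun l hl => ?_⟩) _ fun S => by
      simp [Finset.mem_bipartiteAbove, rooms, and_assoc]
    -- If `e k` were not a candidate, `τ` would consist of points `e j` with `j ≠ l`; its colours
    -- then force `l = i₀` and `τ = τ₀`.
    by_contra! hle
    have hml : m l ∈ Set.range e := by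
      by_contra h
      exact absurd hle (not_le.2 (hhigh l k _ hl h))
    have hall : ∀ x ∈ τ, ∃ j, j ≠ l ∧ e j = x := fun x hx => by
      have hxl : p l (e k) ≤ p l x := hle.trans (hmin l x hx)
      have : x ∈ Set.range e := by
        by_contra h
        exact absurd hxl (not_le.2 (hhigh l k _ hl h))
      obtain ⟨j, rfl⟩ := this
      refine ⟨j, ?_, rfl⟩
      rintro rfl
      exact absurd hxl (not_le.2 (hlow j _ fun h => hl (he h).symm))
    have hl₀ : l = i₀ := by
      by_contra h
      have : l ∈ τ.image c := by rw [hτi]; simpa using h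
      obtain ⟨x, hx, hxl⟩ := Finset.mem_image.1 this
      obtain ⟨j, hj, rfl⟩ := hall x hx
      exact hj (by rw [← hc j, hxl])
    subst hl₀
    exact hτne (hsub τ₀ hτ₀card fun x hx => (hτ₀mem x).2 (hall x hx))
  rw [← Finset.add_sum_erase _ _ hτ₀door, hone, Finset.sum_congr rfl htwo] at hcount
  rw [← hcount, Finset.sum_const, smul_eq_mul] at heven
  rcases heven with ⟨a, ha⟩
  omega

/-! ### From Scarf's lemma to the KKM lemma. -/

/-- In the grid of nonnegative integer points with coordinate sum `N`, coloured by the coordinates,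
there is a point such that each of its coordinates is small or belongs to a colour that occurs
nearby. -/
theorem exists_grid_point {I : Type*} [Fintype I] [Nonempty I] (N : ℕ) (c : (I → ℕ) → I) :
    ∃ z : I → ℕ, ∑ j, z j = N ∧ ∀ i, z i ≤ Fintype.card I ∨
      ∃ x : I → ℕ, ∑ j, x j = N ∧ c x = i ∧
        ∀ j, x j ≤ z j + Fintype.card I ∧ z j ≤ x j + Fintype.card I := by
  classical
  let T := {x : I → Fin (N + 1) // ∑ j, (x j : ℕ) = N}
  have hTle : ∀ (t : T) i, (t.1 i : ℕ) ≤ N := fun t i => Nat.lt_succ_iff.1 (t.1 i).2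
  have hTmk : ∀ y : I → ℕ, ∑ j, y j = N → ∃ t : T, ∀ j, (t.1 j : ℕ) = y j := fun y hy => by
    have hle : ∀ j, y j < N + 1 := fun j => Nat.lt_succ_iff.2
      (hy ▸ Finset.single_le_sum (fun k _ => Nat.zero_le (y k)) (Finset.mem_univ j))
    exact ⟨⟨fun j => ⟨y j, hle j⟩, hy⟩, fun j => rfl⟩
  let M := Fintype.card T
  let idx : T → ℕ := fun t => Fintype.equivFin T t
  have hidx : ∀ t, idx t < M := fun t => (Fintype.equivFin T t).2
  have hidxinj : Function.Injective idx := fun a b h =>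
    (Fintype.equivFin T).injective (Fin.ext h)
  let idy : I → ℕ := fun t => Fintype.equivFin I t
  have hidyinj : Function.Injective idy := fun a b h =>
    (Fintype.equivFin I).injective (Fin.ext h)
  -- Ranking `i` compares `i`-th coordinates, ties being broken by `idx`. The shift by `1` reserves
  -- rank `0` for the extremal point `inr i`; the offset `1 + (N * M + M)` puts the other extremal
  -- points above the grid.
  let p : I → T ⊕ I → ℕ := fun i => Sum.elim (fun t => 1 + ((t.1 i : ℕ) * M + idx t))
    (fun j => if j = i then 0 else 1 + (N * M + M) + idy j)
  have hbound : ∀ (t : T) i, (t.1 i : ℕ) * M + idx t < N * M + M := fun t i => by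
    have := Nat.mul_le_mul_right M (hTle t i)
    have := hidx t
    omega
  have hmono : ∀ i (s t : T), p i (Sum.inl s) ≤ p i (Sum.inl t) → (s.1 i : ℕ) ≤ t.1 i := by
    intro i s t h
    by_contra! hlt
    have h1 := Nat.mul_le_mul_right M (Nat.succ_le_of_lt hlt)
    rw [Nat.succ_mul] at h1
    have := hidx t
    simp only [p, Sum.elim_inl] at h
    omega
  have hp : ∀ i, Function.Injective (p i) := by
    rintro i (s | j) (t | k) h
    · have h1 := hmono i s t h.le
      have h2 := hmono i t s h.ge
      have h3 : (s.1 i : ℕ) = t.1 i := le_antisymm h1 h2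
      simp only [p, Sum.elim_inl, h3] at h
      rw [hidxinj (by omega : idx s = idx t)]
    · have := hbound s i
      simp only [p, Sum.elim_inl, Sum.elim_inr] at h
      split_ifs at h <;> omega
    · have := hbound t i
      simp only [p, Sum.elim_inl, Sum.elim_inr] at h
      split_ifs at h <;> omega
    · simp only [p, Sum.elim_inr] at h
      split_ifs at h with h1 h2 h2
      · rw [h1, h2]
      · omega
      · omega
      · rw [hidyinj (by omega : idy j = idy k)]
  obtain ⟨t₀, -⟩ := hTmk (Pi.single (Classical.arbitrary I) N) (by simp)
  obtain ⟨S, hS, hSc⟩ := exists_isDominant_image_eq_univ p hp Sum.inr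
    (by
      rintro i (t | j) h
      · simp [p]
      · have : j ≠ i := fun h' => h (by rw [h'])
        simp only [p, Sum.elim_inr, if_neg this, if_true]
        omega)
    (by
      rintro i j (t | k) hij h
      · have := hbound t i
        simp only [p, Sum.elim_inr, Sum.elim_inl, if_neg hij.symm]
        omega
      · exact absurd ⟨k, rfl⟩ h)
    ⟨Sum.inl t₀, by simp⟩ (Sum.elim (fun t => c fun j => t.1 j) id) (fun i => rfl)
  have hnotinr : ∀ (y : T) i, (∀ x ∈ S, p i (Sum.inl y) ≤ p i x) → Sum.inr i ∉ S := by
    intro y i h hi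
    have := h _ hi
    simp [p] at this
  have hcol : ∀ i, Sum.inr i ∈ S ∨ ∃ t : T, Sum.inl t ∈ S ∧ c (fun j => t.1 j) = i := by
    intro i
    obtain ⟨v, hv, hvi⟩ := Finset.mem_image.1 (hSc ▸ Finset.mem_univ i)
    rcases v with t | j
    · exact Or.inr ⟨t, hv, hvi⟩
    · exact Or.inl ((show j = i from hvi) ▸ hv)
  obtain ⟨j₀, hj₀⟩ : ∃ j, Sum.inr j ∉ S := by
    obtain ⟨i, hi⟩ := hS (Sum.inl t₀)
    exact ⟨i, hnotinr t₀ i hi⟩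
  obtain ⟨z, hz, -⟩ := (hcol j₀).resolve_left hj₀
  have hmin : ∀ j, ∃ a : T, Sum.inl a ∈ S ∧ ∀ x : T, Sum.inl x ∈ S → (a.1 j : ℕ) ≤ x.1 j := by
    intro j
    obtain ⟨a, ha, ha'⟩ := Finset.exists_min_image (Finset.univ.filter fun t : T => Sum.inl t ∈ S)
      (fun t => (t.1 j : ℕ)) ⟨z, by simpa using hz⟩
    exact ⟨a, by simpa using ha, fun x hx => ha' x (by simpa using hx)⟩
  choose a ha hamin using hmin
  -- A grid point `y` with `b j ≤ y j` for all `j` would contradict dominance, so `N < ∑ j, b j`. As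
  -- members of `S` satisfy `b j ≤ x j + 1` and have sum `N`, each coordinate is pinned to within
  -- the number of colours.
  let b : I → ℕ := fun j => if Sum.inr j ∈ S then 0 else (a j).1 j + 1
  have hb : N < ∑ j, b j := by
    by_contra! hle
    obtain ⟨y, hy⟩ := hTmk (fun j => b j + Pi.single (M := fun _ => ℕ) j₀ (N - ∑ j, b j) j) (by
      rw [Finset.sum_add_distrib, Finset.sum_pi_single' j₀]
      simp only [Finset.mem_univ, if_true]
      omega)
    obtain ⟨i, hi⟩ := hS (Sum.inl y)
    have h1 := hnotinr y i hi
    have h2 := hmono i _ _ (hi _ (ha i))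
    rw [hy i] at h2
    simp only [b, if_neg h1] at h2
    omega
  have hble : ∀ x : T, Sum.inl x ∈ S → ∀ j, b j ≤ x.1 j + 1 := by
    intro x hx j
    simp only [b]
    split_ifs
    · omega
    · have := hamin j x hx
      omega
  have hxle : ∀ x : T, Sum.inl x ∈ S → ∀ j, (x.1 j : ℕ) + 1 < b j + Fintype.card I := by
    intro x hx j
    have h1 : ∑ k ∈ Finset.univ.erase j, b k ≤ ∑ k ∈ Finset.univ.erase j, ((x.1 k : ℕ) + 1) :=
      Finset.sum_le_sum fun k _ => hble x hx k
    have h2 := Finset.add_sum_erase Finset.univ b (Finset.mem_univ j)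
    have h3 := Finset.add_sum_erase Finset.univ (fun k => (x.1 k : ℕ) + 1) (Finset.mem_univ j)
    have h4 : ∑ k, ((x.1 k : ℕ) + 1) = N + Fintype.card I := by
      rw [Finset.sum_add_distrib, x.2]; simp
    omega
  refine ⟨fun j => z.1 j, z.2, fun i => ?_⟩
  rcases hcol i with hi | ⟨x, hx, hxi⟩
  · left
    show (z.1 i : ℕ) ≤ _
    have := hxle z hz i
    simp only [b, if_pos hi] at this
    omega
  · refine Or.inr ⟨fun j => x.1 j, x.2, hxi, fun j => ?_⟩
    have h1 := hxle x hx j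
    have h2 := hxle z hz j
    have h3 := hble x hx j
    have h4 := hble z hz j
    show (x.1 j : ℕ) ≤ z.1 j + _ ∧ (z.1 j : ℕ) ≤ x.1 j + _
    omega

/-- Dual form of the **Knaster–Kuratowski–Mazurkiewicz lemma**: closed sets which cover the standard
simplex and contain the opposite facets have a common point. -/
theorem exists_mem_stdSimplex_forall_mem {I : Type*} [Fintype I] [Nonempty I]
    (G : I → Set (I → ℝ)) (hG : ∀ i, IsClosed (G i))
    (hcover : ∀ x ∈ stdSimplex ℝ I, ∃ i, x ∈ G i)
    (hfacet : ∀ x ∈ stdSimplex ℝ I, ∀ i, x i = 0 → x ∈ G i) :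
    ∃ x ∈ stdSimplex ℝ I, ∀ i, x ∈ G i := by
  classical
  let n := Fintype.card I
  have happrox : ∀ k : ℕ, ∃ z ∈ stdSimplex ℝ I, ∀ i, z i ≤ n / (k + 1 : ℝ) ∨
      ∃ x ∈ G i, dist x z ≤ n / (k + 1 : ℝ) := by
    intro k
    have hk : (0 : ℝ) < k + 1 := by positivity
    let s : (I → ℕ) → I → ℝ := fun x j => (x j : ℝ) / (k + 1)
    have hs : ∀ x : I → ℕ, ∑ j, x j = k + 1 → s x ∈ stdSimplex ℝ I := fun x hx => by
      refine ⟨fun j => by positivity, ?_⟩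
      rw [← Finset.sum_div, ← Nat.cast_sum, hx]
      push_cast
      exact div_self hk.ne'
    have hcol : ∀ x : I → ℕ, ∃ i, ∑ j, x j = k + 1 → s x ∈ G i := fun x => by
      by_cases hx : ∑ j, x j = k + 1
      · obtain ⟨i, hi⟩ := hcover _ (hs x hx)
        exact ⟨i, fun _ => hi⟩
      · exact ⟨Classical.arbitrary I, fun h => absurd h hx⟩
    choose c hc using hcol
    obtain ⟨z, hz, hz'⟩ := exists_grid_point (k + 1) c
    refine ⟨s z, hs z hz, fun i => ?_⟩
    rcases hz' i with h | ⟨x, hx, rfl, hd⟩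
    · left
      exact div_le_div_of_nonneg_right (by exact_mod_cast h) hk.le
    · refine Or.inr ⟨s x, hc x hx, (dist_pi_le_iff (by positivity)).2 fun j => ?_⟩
      obtain ⟨h1, h2⟩ := hd j
      have h1' : (x j : ℝ) ≤ z j + n := by exact_mod_cast h1
      have h2' : (z j : ℝ) ≤ x j + n := by exact_mod_cast h2
      rw [Real.dist_eq, ← sub_div, abs_div, abs_of_pos hk]
      exact div_le_div_of_nonneg_right (abs_le.2 ⟨by linarith, by linarith⟩) hk.le
  choose z hz hz' using happrox
  obtain ⟨y, hy, φ, hφ, hlim⟩ := (isCompact_stdSimplex ℝ I).tendsto_subseq hz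
  refine ⟨y, hy, fun i => ?_⟩
  -- If `y ∉ G i`, then `y i > 0` by the facet condition. Far along the subsequence both
  -- alternatives fail: the `i`-th coordinate stays away from `0`, and the points of `G i` near `z`
  -- would enter a ball about `y` missing `G i`.
  by_contra hyi
  have hyi0 : 0 < y i := lt_of_le_of_ne (hy.1 i) fun h => hyi (hfacet y hy i h.symm)
  obtain ⟨ε, hε, hball⟩ := Metric.isOpen_iff.1 (hG i).isOpen_compl y hyi
  have hsmall : Filter.Tendsto (fun k : ℕ => (n : ℝ) / ((φ k : ℕ) + 1 : ℝ)) Filter.atTop (𝓝 0) :=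
    (tendsto_const_nhds.div_atTop (Filter.tendsto_atTop_add_const_right _ _
      tendsto_natCast_atTop_atTop)).comp hφ.tendsto_atTop
  have hlimi := (continuous_apply i).continuousAt.tendsto.comp hlim
  obtain ⟨k, h1, h2, h3, h4⟩ := ((hsmall.eventually_lt_const (half_pos hyi0)).and
    ((hlimi.eventually_const_lt (half_lt_self hyi0)).and
    ((hsmall.eventually_lt_const (half_pos hε)).and
      (Metric.tendsto_nhds.1 hlim (ε / 2) (half_pos hε))))).exists
  simp only [Function.comp_apply] at h2 h4
  rcases hz' (φ k) i with h | ⟨x, hx, hd⟩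
  · linarith
  · refine hball (Metric.mem_ball.2 ?_) hx
    linarith [dist_triangle x (z (φ k)) y]

/-- The **Knaster–Kuratowski–Mazurkiewicz lemma**. -/
theorem knaster_kuratowski_mazurkiewicz {I : Type*} [Fintype I] [Nonempty I]
    (F : I → Set (I → ℝ)) (hF : ∀ i, IsClosed (F i))
    (hcover : ∀ x ∈ stdSimplex ℝ I, ∃ i, x i ≠ 0 ∧ x ∈ F i) :
    ∃ x ∈ stdSimplex ℝ I, ∀ i, x ∈ F i := by
  classical
  have hne : ∀ i, (F i).Nonempty := fun i => by
    obtain ⟨j, hj, hj'⟩ := hcover (Pi.single i 1) (single_mem_stdSimplex ℝ i)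
    have : j = i := by
      by_contra h
      exact hj (Pi.single_eq_of_ne h _)
    exact ⟨_, this ▸ hj'⟩
  let d : I → (I → ℝ) → ℝ := fun i x => Metric.infDist x (F i)
  have hd : ∀ i, Continuous (d i) := fun i => Metric.continuous_infDist_pt _
  have hd0 : ∀ i x, 0 ≤ d i x := fun i x => Metric.infDist_nonneg
  let s : (I → ℝ) → ℝ := fun x => ∑ j, d j x
  have hsum : ∀ x ∈ stdSimplex ℝ I, ∑ i, s x * x i = ∑ i, d i x := fun x hx => by
    rw [← Finset.mul_sum, hx.2, mul_one]
  -- Both sides of `s x * x i ≤ d i x` have the same sum over `i`. Hence these sets cover the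
  -- simplex, and at a common point all the inequalities are equalities.
  obtain ⟨x, hx, hxG⟩ := exists_mem_stdSimplex_forall_mem (fun i => {x | s x * x i ≤ d i x})
    (fun i => isClosed_le ((continuous_finsetSum _ fun j _ => hd j).mul (continuous_apply i))
      (hd i))
    (fun x hx => by
      obtain ⟨i, -, hi⟩ := Finset.exists_le_of_sum_le Finset.univ_nonempty (hsum x hx).le
      exact ⟨i, hi⟩)
    (fun x _ i hi => by simpa [hi] using hd0 i x)
  refine ⟨x, hx, fun i => (hF i).mem_iff_infDist_zero (hne i) |>.2 ?_⟩
  have heq := (Finset.sum_eq_sum_iff_of_le fun i _ => hxG i).1 (hsum x hx)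
  obtain ⟨j, hj, hjF⟩ := hcover x hx
  have h0 : s x * x j = 0 := by
    rw [heq j (Finset.mem_univ j)]
    exact Metric.infDist_zero_of_mem hjF
  have hs0 : s x = 0 := (mul_eq_zero.1 h0).resolve_right hj
  have := heq i (Finset.mem_univ i)
  rw [hs0, zero_mul] at this
  exact this.symm

/-! ### The cone order and strict negativity. -/

section Cone

variable {E Z : Type*} [AddCommGroup Z] [Module ℝ Z] [TopologicalSpace Z]
  {C : PointedCone ℝ Z}

theorem PointedCone.smul_mem_neg_interior [ContinuousConstSMul ℝ Z] {a : Z}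
    (ha : a ∈ -interior (C : Set Z)) {t : ℝ} (ht : 0 < t) : t • a ∈ -interior (C : Set Z) := by
  have h1 : t • -a ∈ interior (t • (C : Set Z)) := by
    rw [interior_smul₀ ht.ne']
    exact Set.smul_mem_smul_set ha
  have h2 : t • (C : Set Z) ⊆ C := by
    rintro _ ⟨u, hu, rfl⟩
    exact C.smul_mem ht.le hu
  have h3 := interior_mono h2 h1
  rw [smul_neg] at h3
  exact h3

variable [IsTopologicalAddGroup Z]

/-- Since `int C + C ⊆ int (C + C)` and `C + C ⊆ C`, strict negativity passes to smaller elements.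
This is how semicontinuity and `C`-convexity are exploited. -/
theorem PointedCone.mem_neg_interior_of_sub_mem {a b : Z} (ha : a ∈ -interior (C : Set Z))
    (hab : a - b ∈ C) : b ∈ -interior (C : Set Z) := by
  have h1 : -a + (a - b) ∈ interior ((C : Set Z) + (C : Set Z)) :=
    subset_interior_add_left (Set.add_mem_add ha hab)
  have h2 : (C : Set Z) + (C : Set Z) ⊆ C := by
    rintro _ ⟨u, hu, v, hv, rfl⟩
    exact C.add_mem hu hv
  have h3 := interior_mono h2 h1
  rw [neg_add_eq_sub, sub_sub_cancel_left] at h3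
  exact h3

theorem PointedCone.convex_neg_interior [ContinuousConstSMul ℝ Z] :
    Convex ℝ (-interior (C : Set Z)) :=
  Convex.neg (Convex.interior C.convex)

/-- An upper semicontinuous map stays strictly negative near a point where it is so. -/
theorem CUpperSemicontinuousWithinAt.exists_mem_neg_interior [TopologicalSpace E] {g : E → Z}
    {K : Set E} {x : E} (hg : CUpperSemicontinuousWithinAt C g K x)
    (hx : g x ∈ -interior (C : Set Z)) :
    ∃ U ∈ 𝓝 x, ∀ u ∈ U ∩ K, g u ∈ -interior (C : Set Z) := by
  obtain ⟨U, hU, h⟩ := hg _ (isOpen_interior.neg.mem_nhds hx)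
  refine ⟨U, hU, fun u hu => ?_⟩
  obtain ⟨v, hv, c, hc, hvc⟩ := h u hu
  refine PointedCone.mem_neg_interior_of_sub_mem hv ?_
  rw [← hvc]
  simpa using hc

end Cone

theorem Finset.sum_equivFin_symm {E M : Type*} [AddCommMonoid M] (s : Finset E) (F : E → M) :
    ∑ i, F (s.equivFin.symm i) = ∑ y ∈ s, F y := by
  rw [Equiv.sum_comp s.equivFin.symm fun y : s => F y, Finset.sum_coe_sort]

/-- Reindexes `C`-convexity from `Fin n` to a `Finset`, the form in which `Finset.mem_convexHull'`
supplies weights. -/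
theorem CConvexOn.sum_sub_mem {E Z : Type*} [AddCommGroup E] [Module ℝ E] [AddCommGroup Z]
    [Module ℝ Z] {C : PointedCone ℝ Z} {g : E → Z} {S : Set E} (hg : CConvexOn C g S)
    (s : Finset E) (w : E → ℝ) (hs : ∀ y ∈ s, y ∈ S) (hw : ∀ y ∈ s, 0 ≤ w y)
    (hw1 : ∑ y ∈ s, w y = 1) (hmem : ∑ y ∈ s, w y • y ∈ S) :
    ∑ y ∈ s, w y • g y - g (∑ y ∈ s, w y • y) ∈ C := by
  have h := hg s.card (fun i => s.equivFin.symm i) (fun i => w (s.equivFin.symm i))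
    (fun i => hs _ (s.equivFin.symm i).2) (fun i => hw _ (s.equivFin.symm i).2)
    (by rw [s.sum_equivFin_symm w, hw1]) (by rwa [s.sum_equivFin_symm fun y => w y • y])
  rwa [s.sum_equivFin_symm fun y => w y • y, s.sum_equivFin_symm fun y => w y • g y] at h

/-! ### Self-segment-dense sets and equilibria on compact convex sets. -/

section Topological

variable {E : Type*} [AddCommGroup E] [Module ℝ E] [TopologicalSpace E]
  [IsTopologicalAddGroup E] [ContinuousSMul ℝ E]

/-- A self-segment-dense set is dense in the convex hull of each of its finite subsets. -/
theorem SelfSegmentDense.convexHull_subset_closure {D K : Set E} (hD : SelfSegmentDense D K)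
    {s : Set E} (hs : s.Finite) (hsD : s ⊆ D) :
    convexHull ℝ s ⊆ closure (convexHull ℝ s ∩ D) := by
  induction s, hs using Set.Finite.induction_on with
  | empty => simp
  | @insert x s _ _ ih =>
    have hxD := hsD (Set.mem_insert x s)
    replace ih := ih ((Set.subset_insert x s).trans hsD)
    rcases s.eq_empty_or_nonempty with rfl | hne
    · intro z hz
      have : z = x := by simpa using hz
      exact subset_closure ⟨hz, this ▸ hxD⟩
    intro z hz
    rw [convexHull_insert hne, mem_convexJoin] at hz
    obtain ⟨x, rfl, v, hv, a, b, ha, hb, hab, rfl⟩ := hz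
    -- By induction `v` is a limit of points `w ∈ D` of the smaller hull. Each `a • x + b • w` lies
    -- on a segment with both ends in `D`, where segment density applies.
    have hcont : Continuous fun w : E => a • x + b • w := by fun_prop
    have hmaps : Set.MapsTo (fun w : E => a • x + b • w) (convexHull ℝ s ∩ D)
        (closure (convexHull ℝ (insert x s) ∩ D)) := by
      rintro w ⟨hw, hwD⟩
      refine closure_mono ?_ (hD.segment_dense x hxD w hwD ⟨a, b, ha, hb, hab, rfl⟩)
      refine Set.inter_subset_inter_left _ ((convex_convexHull ℝ _).segment_subset
        (subset_convexHull ℝ _ (Set.mem_insert x s))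
        (convexHull_mono (Set.subset_insert x s) hw))
    exact (hmaps.closure_of_continuousOn hcont.continuousOn |>.mono_right
      isClosed_closure.closure_subset) (ih hv)

/-- The Knaster–Kuratowski–Mazurkiewicz lemma for finitely many points of a topological vector
space. -/
theorem exists_mem_convexHull_forall_mem {I : Type*} [Fintype I] [Nonempty I] (y : I → E)
    (F : I → Set E) (hF : ∀ i, IsClosed (F i))
    (hcover : ∀ J : Set I, ∀ x ∈ convexHull ℝ (y '' J), ∃ i ∈ J, x ∈ F i) :
    ∃ x ∈ convexHull ℝ (Set.range y), ∀ i, x ∈ F i := by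
  have hcont : Continuous fun w : I → ℝ => ∑ i, w i • y i := by fun_prop
  obtain ⟨w, hw, hwF⟩ := knaster_kuratowski_mazurkiewicz
    (fun i => (fun w : I → ℝ => ∑ i, w i • y i) ⁻¹' F i) (fun i => (hF i).preimage hcont)
    (fun w hw => by
      obtain ⟨i, hi, hiF⟩ := hcover {i | w i ≠ 0} (∑ i, w i • y i) (by
        classical
        rw [← Finset.sum_filter_of_ne (p := fun i => w i ≠ 0)
          (fun i _ h h0 => h (by rw [h0, zero_smul]))]
        refine (convex_convexHull ℝ _).sum_mem (fun i _ => hw.1 i) ?_ fun i hi =>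
          subset_convexHull ℝ _ ⟨i, (Finset.mem_filter.1 hi).2, rfl⟩
        rw [Finset.sum_filter_ne_zero]
        exact hw.2)
      exact ⟨i, hi, hiF⟩)
  exact ⟨_, (convex_convexHull ℝ _).sum_mem (fun i _ => hw.1 i) hw.2 fun i _ =>
    subset_convexHull ℝ _ ⟨i, rfl⟩, hwF⟩

/-- Existence of a weak equilibrium with respect to the points of a self-segment-dense set that lie
in a compact convex set. -/
theorem exists_forall_mem_notMem_neg_interior {Z : Type*} [AddCommGroup Z] [Module ℝ Z]
    [TopologicalSpace Z] [IsTopologicalAddGroup Z] [ContinuousConstSMul ℝ Z]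
    {C : PointedCone ℝ Z} {K D M : Set E} (hD : SelfSegmentDense D K) (hM : IsCompact M)
    (hMcl : IsClosed M) (hMconv : Convex ℝ M) (hMK : M ⊆ K) (hne : (D ∩ M).Nonempty)
    (f : E → E → Z)
    (husc : ∀ y ∈ D, ∀ x ∈ K, CUpperSemicontinuousWithinAt C (fun u => f u y) K x)
    (hconv : ∀ x ∈ K, CConvexOn C (f x) D) (hdiag : ∀ x ∈ D, f x x ∉ -interior (C : Set Z)) :
    ∃ x ∈ M, ∀ y ∈ D ∩ M, f x y ∉ -interior (C : Set Z) := by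
  classical
  let G : E → Set E := fun y => {x | x ∈ M ∧ f x y ∉ -interior (C : Set Z)}
  have hG : ∀ y ∈ D, IsClosed (G y) := fun y hy => by
    refine isClosed_iff_nhds.2 fun x hx => ?_
    have hxM : x ∈ M := hMcl.closure_subset_iff.2 (fun u hu => hu.1)
      (mem_closure_iff_nhds.2 hx : x ∈ closure (G y))
    refine ⟨hxM, fun hneg => ?_⟩
    obtain ⟨U, hU, h⟩ := (husc y hy x (hMK hxM)).exists_mem_neg_interior hneg
    obtain ⟨u, huU, huM, hu⟩ := hx U hU
    exact hu (h u ⟨huU, hMK huM⟩)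
  have hfin : ∀ s : Finset E, (s : Set E).Nonempty → (s : Set E) ⊆ D ∩ M →
      ∀ x ∈ convexHull ℝ (s : Set E), ∃ y ∈ s, x ∈ G y := by
    intro s hsne hs x hx
    have hcl : IsClosed (⋃ y ∈ s, G y) :=
      s.finite_toSet.isClosed_biUnion fun y hy => hG y (hs hy).1
    -- At a point of `D` both `C`-convexity and the diagonal condition are available: if all `f x y`
    -- with `y ∈ s` were strictly negative, so would be `f x x`.
    have hsub : convexHull ℝ (s : Set E) ∩ D ⊆ ⋃ y ∈ s, G y := by
      rintro x ⟨hx, hxD⟩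
      have hxM : x ∈ M := convexHull_min (fun y hy => (hs hy).2) hMconv hx
      by_contra hnot
      simp only [Set.mem_iUnion, not_exists] at hnot
      have hall : ∀ y ∈ s, f x y ∈ -interior (C : Set Z) := fun y hy => by
        by_contra h
        exact hnot y hy ⟨hxM, h⟩
      obtain ⟨w, hw, hw1, rfl⟩ := Finset.mem_convexHull'.1 hx
      have h1 := (hconv _ (hMK hxM)).sum_sub_mem s w (fun y hy => (hs hy).1) hw hw1 hxD
      exact hdiag _ hxD (PointedCone.mem_neg_interior_of_sub_mem
        (PointedCone.convex_neg_interior.sum_mem hw hw1 hall) h1)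
    have := closure_minimal hsub hcl
      (hD.convexHull_subset_closure s.finite_toSet (fun y hy => (hs hy).1) hx)
    simpa using this
  obtain ⟨y₀, hy₀⟩ := hne
  obtain ⟨x, hxM, hx⟩ := hM.inter_iInter_nonempty (fun y : ↥(D ∩ M) => G y)
    (fun y => hG y y.2.1) fun u => by
      -- Adding `y₀` keeps the index set nonempty and places the common point in `M` even when `u`
      -- is empty.
      let v : Finset ↥(D ∩ M) := insert ⟨y₀, hy₀⟩ u
      have : Nonempty v := ⟨⟨_, Finset.mem_insert_self _ _⟩⟩
      obtain ⟨x, hx, hxG⟩ := exists_mem_convexHull_forall_mem (I := v) (fun y => (y.1 : E))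
        (fun y => G y.1) (fun y => hG _ y.1.2.1) fun J x hx => by
          have hJ : ((J.toFinset.image fun y : v => (y.1 : E) : Finset E) : Set E) =
            (fun y : v => (y.1 : E)) '' J := by simp
          rw [← hJ] at hx
          obtain ⟨y, hy, hyG⟩ := hfin _ (convexHull_nonempty_iff.1 ⟨x, hx⟩) (by
            rw [hJ]
            rintro _ ⟨y, -, rfl⟩
            exact y.1.2) x hx
          obtain ⟨j, hj, rfl⟩ := Finset.mem_image.1 hy
          exact ⟨j, by simpa using hj, hyG⟩
      have h0 := hxG ⟨⟨y₀, hy₀⟩, Finset.mem_insert_self _ _⟩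
      refine ⟨x, h0.1, Set.mem_iInter₂.2 fun y hy => hxG ⟨y, Finset.mem_insert_of_mem hy⟩⟩
  exact ⟨x, hxM, fun y hy => (Set.mem_iInter.1 hx ⟨y, hy⟩).2⟩

end Topological

/-! ### Weak compactness and segments in the weak topology. -/

section Weak

variable {X : Type*} [NormedAddCommGroup X] [NormedSpace ℝ X]

theorem isClosed_toWeakSpace_image {s : Set X} (hs : IsClosed s) (hconv : Convex ℝ s) :
    IsClosed (toWeakSpace ℝ X '' s) := by
  have := hconv.toWeakSpace_closure ℝ
  rw [hs.closure_eq] at this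
  rw [this]
  exact isClosed_closure

/-- Bounded sets are relatively weakly compact once the weak-star limits in the bidual come from
points of the space, which is what reflexivity gives; convexity makes the norm-closed set weakly
closed. -/
theorem IsReflexiveSpace.isCompact_toWeakSpace_image (hX : IsReflexiveSpace X) {s : Set X}
    (hs : IsClosed s) (hconv : Convex ℝ s) (hb : Bornology.IsBounded s) :
    IsCompact (toWeakSpace ℝ X '' s) := by
  rw [← (isClosed_toWeakSpace_image hs hconv).closure_eq]
  refine NormedSpace.isCompact_closure_of_isBounded ℝ X (toWeakSpace ℝ X '' s)
    (by rwa [Set.preimage_image_eq _ (toWeakSpace ℝ X).injective]) fun φ _ => ?_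
  obtain ⟨x, hx⟩ := hX (WeakDual.toStrongDual φ)
  exact ⟨toWeakSpace ℝ X x, DFunLike.ext _ _ fun l => congrArg (fun ψ => ψ l) hx⟩

/-- Near the endpoint `x`, the segment from `x` to `y` contains points of a self-segment-dense
set. -/
theorem SelfSegmentDense.exists_mem_norm_lt {D K : Set X}
    (hD : SelfSegmentDense (toWeakSpace ℝ X '' D) (toWeakSpace ℝ X '' K)) {x y : X} (hx : x ∈ D)
    (hy : y ∈ D) (hxy : x ≠ y) {r : ℝ} (hr : ‖x‖ < r) :
    ∃ t : ℝ, 0 < t ∧ t ≤ 1 ∧ (1 - t) • x + t • y ∈ D ∧ ‖(1 - t) • x + t • y‖ < r := by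
  have hd : 0 < ‖y - x‖ := norm_pos_iff.2 (sub_ne_zero.2 hxy.symm)
  -- Weak density does not control the norm in general, but on the segment a functional norming `y -
  -- x` measures the distance to `x`. The weakly open strip `0 < l u - l x < r - ‖x‖` thus selects
  -- points other than `x` of norm below `r`.
  obtain ⟨l, hl, hlv⟩ := exists_dual_vector ℝ (y - x) hd.ne'
  replace hlv : l y - l x = ‖y - x‖ := by rw [← map_sub]; exact hlv
  have hlc : ∀ t : ℝ, l ((1 - t) • x + t • y) - l x = t * ‖y - x‖ := fun t => by
    rw [← hlv]; simp; ring
  have hcont : Continuous fun u : WeakSpace ℝ X => l ((toWeakSpace ℝ X).symm u) - l x :=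
    (WeakBilin.eval_continuous (topDualPairing ℝ X).flip l).sub continuous_const
  -- The point of the segment at distance `η` from `x` shows that the strip meets the segment.
  let η := min (r - ‖x‖) ‖y - x‖ / 2
  have hmin : 0 < min (r - ‖x‖) ‖y - x‖ := lt_min (sub_pos.2 hr) hd
  have hη : 0 < η := half_pos hmin
  have hη1 : η < r - ‖x‖ := (half_lt_self hmin).trans_le (min_le_left _ _)
  have hη2 : η < ‖y - x‖ := (half_lt_self hmin).trans_le (min_le_right _ _)
  have hseg : toWeakSpace ℝ X ((1 - η / ‖y - x‖) • x + (η / ‖y - x‖) • y) ∈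
      segment ℝ (toWeakSpace ℝ X x) (toWeakSpace ℝ X y) :=
    ⟨1 - η / ‖y - x‖, η / ‖y - x‖, sub_nonneg.2 ((div_le_one hd).2 hη2.le), by positivity,
      by ring, by simp⟩
  have hopen : IsOpen ((fun u : WeakSpace ℝ X => l ((toWeakSpace ℝ X).symm u) - l x) ⁻¹'
      Set.Ioo 0 (r - ‖x‖)) := isOpen_Ioo.preimage hcont
  obtain ⟨u, hu, ⟨a, t, ha, ht, hat, rfl⟩, ⟨z, hz, hzu⟩⟩ := mem_closure_iff.1
    (hD.segment_dense _ ⟨x, hx, rfl⟩ _ ⟨y, hy, rfl⟩ hseg) _ hopen (by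
      simp only [Set.mem_preimage, LinearEquiv.symm_apply_apply, hlc,
        div_mul_cancel₀ _ hd.ne']
      exact ⟨hη, hη1⟩)
  obtain rfl : a = 1 - t := by linarith
  have hz' : z = (1 - t) • x + t • y := (toWeakSpace ℝ X).injective (by simpa using hzu)
  rw [← hzu, hz'] at hu
  simp only [Set.mem_preimage, LinearEquiv.symm_apply_apply, hlc] at hu
  refine ⟨t, pos_of_mul_pos_left hu.1 hd.le, by linarith, hz' ▸ hz, ?_⟩
  have heq : (1 - t) • x + t • y = x + t • (y - x) := by module
  rw [heq]
  refine (norm_add_le _ _).trans_lt ?_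
  rw [norm_smul, Real.norm_of_nonneg ht]
  linarith [hu.2]

end Weak

/-! ### The equilibrium theorem. -/

theorem theoremt13 {X Z : Type*}
    [NormedAddCommGroup X] [NormedSpace ℝ X] [CompleteSpace X]
    [AddCommGroup Z] [Module ℝ Z] [TopologicalSpace Z] [IsTopologicalAddGroup Z]
    [ContinuousSMul ℝ Z] [LocallyConvexSpace ℝ Z] [T2Space Z]
    (hX : IsReflexiveSpace X)
    (C : PointedCone ℝ Z)
    (hCpointed : (C : Set Z) ∩ -(C : Set Z) = {0})
    (hCint : (interior (C : Set Z)).Nonempty)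
    (K D : Set X) (hKne : K.Nonempty) (hKconv : Convex ℝ K) (hKcl : IsClosed K)
    (hD : SelfSegmentDense (toWeakSpace ℝ X '' D) (toWeakSpace ℝ X '' K))
    (f : X → X → Z)
    (h_i : ∀ y ∈ D, ∀ x ∈ K,
      CUpperSemicontinuousWithinAt C
        (fun u : WeakSpace ℝ X => f ((toWeakSpace ℝ X).symm u) y)
        (toWeakSpace ℝ X '' K) (toWeakSpace ℝ X x))
    (h_ii : ∀ x ∈ K, ∀ y ∈ K \ D,
      CUpperSemicontinuousWithinAt C
        (fun u : WeakSpace ℝ X => f x ((toWeakSpace ℝ X).symm u))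
        (toWeakSpace ℝ X '' K) (toWeakSpace ℝ X y))
    (h_iii : ∀ x ∈ K, CConvexOn C (fun y => f x y) D)
    (h_iv : ∀ x ∈ D, f x x ∉ -interior (C : Set Z))
    (h_v : ∃ r : ℝ, 0 < r ∧ (∃ x ∈ K, ‖x‖ ≤ r) ∧
      ∀ x ∈ K, ‖x‖ ≤ r →
        ∃ y₀ ∈ D, ‖y₀‖ < r ∧ f x y₀ ∈ -interior (C : Set Z) ∪ {0}) :
    ∃ x₀ ∈ K, ∀ y ∈ K, f x₀ y ∉ -interior (C : Set Z) := by
  obtain ⟨r, hr, ⟨x₁, hx₁K, hx₁⟩, hcoer⟩ := h_v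
  let e := toWeakSpace ℝ X
  have hMcl : IsClosed (K ∩ Metric.closedBall 0 r) := hKcl.inter Metric.isClosed_closedBall
  have hMconv : Convex ℝ (K ∩ Metric.closedBall 0 r) := hKconv.inter (convex_closedBall 0 r)
  have hDK : D ⊆ K := (Set.image_subset_image_iff e.injective).1 hD.subset
  have hball : ∀ y ∈ D, ‖y‖ ≤ r → e y ∈ e '' D ∩ e '' (K ∩ Metric.closedBall 0 r) :=
    fun y hy hyr => ⟨⟨y, hy, rfl⟩, y, ⟨hDK hy, by simpa using hyr⟩, rfl⟩
  obtain ⟨y₁, hy₁D, hy₁, -⟩ := hcoer x₁ hx₁K hx₁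
  obtain ⟨_, ⟨x₀, ⟨hx₀K, hx₀r⟩, rfl⟩, hx₀⟩ := exists_forall_mem_notMem_neg_interior (C := C) hD
    (hX.isCompact_toWeakSpace_image hMcl hMconv
      (Metric.isBounded_closedBall.subset Set.inter_subset_right))
    (isClosed_toWeakSpace_image hMcl hMconv)
    (hMconv.linear_image e.toLinearMap)
    (Set.image_mono Set.inter_subset_left) ⟨_, hball y₁ hy₁D hy₁.le⟩
    (fun u v => f (e.symm u) (e.symm v))
    (by
      rintro _ ⟨y, hy, rfl⟩ _ ⟨x, hx, rfl⟩
      simpa only [e, LinearEquiv.symm_apply_apply] using h_i y hy x hx)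
    (by
      rintro _ ⟨x, hx, rfl⟩ n v w hv hw hw1 hvw
      have hmem : ∀ u, u ∈ e '' D → e.symm u ∈ D := by
        rintro _ ⟨d, hd, rfl⟩
        simpa using hd
      have := h_iii x hx n (fun i => e.symm (v i)) w (fun i => hmem _ (hv i)) hw hw1
        (by simpa using hmem _ hvw)
      simpa [e] using this)
    (by
      rintro _ ⟨x, hx, rfl⟩
      simpa [e] using h_iv x hx)
  have hx₀D : ∀ y ∈ D, ‖y‖ ≤ r → f x₀ y ∉ -interior (C : Set Z) := fun y hy hyr => by
    simpa [e] using hx₀ (e y) (hball y hy hyr)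
  obtain ⟨y₀, hy₀D, hy₀r, hy₀⟩ := hcoer x₀ hx₀K (by simpa using hx₀r)
  -- Since `x₀` already solves the problem against `y₀`, only the value `0` is left in (v).
  have hzero : f x₀ y₀ = 0 := hy₀.resolve_left (hx₀D y₀ hy₀D hy₀r.le)
  have hall : ∀ y ∈ D, f x₀ y ∉ -interior (C : Set Z) := by
    intro y hy hneg
    by_cases hne : y₀ = y
    · exact hx₀D y₀ hy₀D hy₀r.le (hne ▸ hneg)
    obtain ⟨t, ht, ht1, hzD, hzr⟩ := hD.exists_mem_norm_lt hy₀D hy hne hy₀r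
    -- As `f x₀ y₀ = 0`, convexity bounds `f x₀` at the intermediate point by `t • f x₀ y`, which is
    -- strictly negative because `t > 0`.
    have hconv := h_iii x₀ hx₀K 2 ![y₀, y] ![1 - t, t]
      (by simp [Fin.forall_fin_two, hy₀D, hy]) (by simp [Fin.forall_fin_two, ht.le, ht1])
      (by simp) (by simpa using hzD)
    simp only [Fin.sum_univ_two, Matrix.cons_val_zero, Matrix.cons_val_one, hzero, smul_zero,
      zero_add] at hconv
    exact hx₀D _ hzD hzr.le (PointedCone.mem_neg_interior_of_sub_mem
      (PointedCone.smul_mem_neg_interior hneg ht) hconv)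
  refine ⟨x₀, hx₀K, fun y hy hneg => ?_⟩
  by_cases hyD : y ∈ D
  · exact hall y hyD hneg
  obtain ⟨U, hU, h⟩ := (h_ii x₀ hx₀K y ⟨hy, hyD⟩).exists_mem_neg_interior (by simpa using hneg)
  obtain ⟨_, huU, d, hd, rfl⟩ := mem_closure_iff_nhds.1 (hD.dense ⟨y, hy, rfl⟩) U hU
  exact hall d hd (by simpa using h _ ⟨huU, d, hDK hd, rfl⟩)
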